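/- Let $G$ be a finite group of odd order and let $p$ be a prime. Suppose that $G = HV$ with $H\cap V=1$, where $H$ is a nonabelian subgroup of $G$ and $V$ is a normal elementary abelian $p$-subgroup of $G$ which, as a module for $H$ over the field with $p$ elements (with $H$ acting by conjugation), is faithful and irreducible. Let $k$ be a subfield of $\mathbb{C}$ that contains a primitive $p$-th root of unity. Let $\mathrm{Irr}_{k,p'}(G)$ be the set of complex irreducible characters $\chi$ of $G$ all of whose values lie in $k$ and whose degree $\chi(1)$ is not divisible by $p$, and let $$\mathrm{acd}_{k,p'}(G)=\frac{1}{|\mathrm{Irr}_{k,p'}(G)|}\sum_{\chi\in \mathrm{Irr}_{k,p'}(G)}\chi(1)$$ be the average of the degrees of these characters. Then the following hold. \begin{enumerate} \item If $p\neq 3$, then $\mathrm{acd}_{k,p'}(G)\ge 3$. \item If $p=3$, then $\mathrm{acd}_{k,3'}(G)\ge \frac{81}{17}$. \end{enumerate} -/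

import Mathlib

/-- `Irr(G)`: the set of characters of the irreducible complex representations of `G`.
Every finite-dimensional complex representation is equivalent to one on some `Fin n → ℂ`. -/
def Irr (G : Type*) [Group G] : Set (G → ℂ) :=
  {χ | ∃ (n : ℕ) (ρ : Representation ℂ G (Fin n → ℂ)), ρ.IsIrreducible ∧ χ = ρ.character}

/-- `Irr_{k,p'}(G)`: the irreducible characters of `G` all of whose values lie in the subfield `k`
of `ℂ` and whose degree `χ(1)` is not divisible by `p`. -/
def IrrKP' (k : Subfield ℂ) (p : ℕ) (G : Type*) [Group G] : Set (G → ℂ) :=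
  {χ | χ ∈ Irr G ∧ (∀ g, χ g ∈ k) ∧ ∃ d : ℕ, χ 1 = (d : ℂ) ∧ ¬ p ∣ d}

/-- `acd_{k,p'}(G)`: the average of the degrees `χ(1)` over `χ ∈ Irr_{k,p'}(G)`. The degrees are
natural numbers, so taking the real part only regards them as real numbers. -/
noncomputable def acdKP' (k : Subfield ℂ) (p : ℕ) (G : Type*) [Group G] : ℝ :=
  (∑ᶠ χ ∈ IrrKP' k p G, (χ 1).re) / ((IrrKP' k p G).ncard : ℝ)

/-- `V` is a (normal) elementary abelian `p`-subgroup of `G` which is a faithful irreducible module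
over the field with `p` elements for the subgroup `H`, acting by conjugation. Because `V` has
exponent `p`, its submodules are exactly the subgroups of `V` that `H` normalizes. -/
structure IsFaithfulIrreducibleModule {G : Type*} [Group G] (p : ℕ) (H V : Subgroup G) : Prop where
  normal : V.Normal
  comm : ∀ v ∈ V, ∀ w ∈ V, v * w = w * v
  pow_eq_one : ∀ v ∈ V, v ^ p = 1
  faithful : ∀ h ∈ H, (∀ v ∈ V, h * v * h⁻¹ = v) → h = 1
  ne_bot : V ≠ ⊥
  irreducible : ∀ W : Subgroup G, W ≤ V → (∀ h ∈ H, ∀ w ∈ W, h * w * h⁻¹ ∈ W) → W = ⊥ ∨ W = V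

namespace Representation

/-- A representation is irreducible iff its space is nontrivial and every invariant subspace is
trivial. -/
theorem isIrreducible_iff_forall_invariant {K G U : Type*} [Field K] [Monoid G] [AddCommGroup U]
    [Module K U] (ρ : Representation K G U) :
    ρ.IsIrreducible ↔ Nontrivial U ∧
      ∀ W : Submodule K U, (∀ g, ∀ w ∈ W, ρ g w ∈ W) → W = ⊥ ∨ W = ⊤ := by
  constructor
  · intro h
    refine ⟨?_, fun W hW => ?_⟩
    · by_contra hU
      rw [not_nontrivial_iff_subsingleton] at hU
      refine bot_ne_top (α := Subrepresentation ρ) ?_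
      exact Subrepresentation.toSubmodule_injective (Subsingleton.elim _ _)
    · rcases h.eq_bot_or_eq_top ⟨W, fun g w hw => hW g w hw⟩ with h | h
      · exact Or.inl (congrArg Subrepresentation.toSubmodule h)
      · exact Or.inr (congrArg Subrepresentation.toSubmodule h)
  · rintro ⟨hU, h⟩
    exact
      { exists_pair_ne := ⟨⊥, ⊤, fun e =>
          bot_ne_top (α := Submodule K U) (congrArg Subrepresentation.toSubmodule e)⟩
        eq_bot_or_eq_top := fun W => by
          rcases h W.toSubmodule (fun g w hw => W.apply_mem_toSubmodule g hw) with h | h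
          · exact Or.inl (Subrepresentation.toSubmodule_injective h)
          · exact Or.inr (Subrepresentation.toSubmodule_injective h) }

/-- The character of an irreducible complex representation belongs to `Irr G`. -/
theorem character_mem_Irr {G U : Type*} [Group G] [AddCommGroup U] [Module ℂ U]
    [FiniteDimensional ℂ U] (ρ : Representation ℂ G U) (hρ : ρ.IsIrreducible) :
    ρ.character ∈ Irr G := by
  obtain ⟨hU, hW⟩ := (isIrreducible_iff_forall_invariant ρ).1 hρ
  let e : U ≃ₗ[ℂ] (Fin (Module.finrank ℂ U) → ℂ) := (Module.finBasis ℂ U).equivFun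
  let σ : Representation ℂ G (Fin (Module.finrank ℂ U) → ℂ) :=
    { toFun := fun g => e.conj (ρ g)
      map_one' := by ext; simp [LinearEquiv.conj_apply]
      map_mul' := fun g h => by ext; simp [LinearEquiv.conj_apply] }
  have hσ : ∀ g u, σ g (e u) = e (ρ g u) := fun g u => by
    change e.conj (ρ g) (e u) = _
    simp [LinearEquiv.conj_apply]
  refine ⟨_, σ, (isIrreducible_iff_forall_invariant σ).2 ⟨e.symm.toEquiv.nontrivial, ?_⟩, ?_⟩
  · intro W hinv
    have hcomap : ∀ g, ∀ w ∈ W.comap e.toLinearMap, ρ g w ∈ W.comap e.toLinearMap :=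
      fun g w hw => by simpa [hσ] using hinv g _ hw
    rcases hW _ hcomap with h | h
    · left
      rw [Submodule.eq_bot_iff] at h ⊢
      intro x hx
      have := h (e.symm x) (by simpa using hx)
      simpa using this
    · right
      rw [Submodule.eq_top_iff'] at h ⊢
      intro x
      simpa using h (e.symm x)
  · ext g
    exact (LinearMap.trace_conj' (ρ g) e).symm

theorem isIntegral_character {G U : Type*} [Group G] [Finite G] [AddCommGroup U] [Module ℂ U]
    [FiniteDimensional ℂ U] (ρ : Representation ℂ G U) (g : G) :
    IsIntegral ℤ (ρ.character g) := by
  unfold character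
  rw [Module.End.trace_eq_sum_roots_charpoly_of_splits (IsAlgClosed.splits _)]
  refine IsIntegral.multiset_sum fun x hx => ?_
  have hev : Module.End.HasEigenvalue (ρ g) x := by
    rw [Module.End.hasEigenvalue_iff_isRoot_charpoly]
    exact (Polynomial.mem_roots'.1 hx).2
  obtain ⟨w, hw⟩ := hev.exists_hasEigenvector
  have hpow : x ^ Nat.card G = 1 := by
    have h1 : (ρ g ^ Nat.card G) w = x ^ Nat.card G • w := hw.pow_apply _
    rw [← map_pow, pow_card_eq_one', map_one] at h1
    have h2 : (x ^ Nat.card G - 1) • w = 0 := by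
      rw [sub_smul, ← h1]; simp
    exact sub_eq_zero.1 ((smul_eq_zero.1 h2).resolve_right hw.2)
  exact IsIntegral.of_pow Nat.card_pos (hpow ▸ isIntegral_one)

theorem sum_character_mul_character_inv {G U : Type*} [Group G] [Fintype G] [AddCommGroup U]
    [Module ℂ U] [FiniteDimensional ℂ U] (ρ : Representation ℂ G U) (hρ : ρ.IsIrreducible) :
    ∑ g : G, ρ.character g * ρ.character g⁻¹ = Nat.card G := by
  classical
  have hne : (Nat.card G : ℂ) ≠ 0 := by exact_mod_cast Nat.card_pos.ne'
  let _ := invertibleOfNonzero hne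
  have h := char_orthonormal ρ ρ
  rw [if_pos ⟨Equiv.refl ρ⟩] at h
  field_simp at h
  simpa using h

/-- The degree of an irreducible complex representation divides the group order. -/
theorem finrank_dvd_card {G U : Type*} [Group G] [Finite G] [AddCommGroup U] [Module ℂ U]
    [FiniteDimensional ℂ U] (ρ : Representation ℂ G U) (hρ : ρ.IsIrreducible) :
    Module.finrank ℂ U ∣ Nat.card G := by
  have := Fintype.ofFinite G
  let z : Module.End ℂ U := ∑ g : G, ρ.character g⁻¹ • ρ g
  have hz : ∀ h u, z (ρ h u) = ρ h (z u) := by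
    intro h u
    simp only [z, LinearMap.sum_apply, LinearMap.smul_apply, map_sum, map_smul]
    refine Fintype.sum_equiv (MulAut.conj h⁻¹).toEquiv _ _ fun g => ?_
    simp only [MulEquiv.toEquiv_eq_coe, EquivLike.coe_coe, MulAut.conj_apply, inv_inv]
    rw [← Module.End.mul_apply, ← map_mul, ← Module.End.mul_apply, ← map_mul]
    have hχ : ρ.character (h⁻¹ * g * h)⁻¹ = ρ.character g⁻¹ := by
      rw [← char_conj ρ g⁻¹ h⁻¹]; congr 1; group
    rw [hχ]
    congr 3
    group
  obtain ⟨c, hc⟩ := (IsIrreducible.algebraMap_intertwiningMap_bijective_of_isAlgClosed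
    (ρ := ρ)).2 (z.intertwiningMap_of_isIntertwiningMap ρ ρ hz)
  have hcz : ∀ u, z u = c • u := fun u => (congrArg (fun f => f u) hc).symm
  have hzc : z = c • (1 : Module.End ℂ U) := LinearMap.ext fun u => by simp [hcz]
  have htr : c * Module.finrank ℂ U = Nat.card G := by
    rw [← sum_character_mul_character_inv ρ hρ]
    have h1 := congrArg (LinearMap.trace ℂ U) hzc
    simp only [z, map_sum, map_smul, LinearMap.trace_one, smul_eq_mul] at h1
    rw [← h1]
    exact Finset.sum_congr rfl fun g _ => mul_comm _ _
  obtain ⟨hU, -⟩ := (isIrreducible_iff_forall_invariant ρ).1 hρ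
  obtain ⟨w, hw⟩ := exists_ne (0 : U)
  let A := integralClosure ℤ ℂ
  have hcA : IsIntegral A c := by
    refine isIntegral_of_smul_mem_submodule
      (Submodule.span A (Set.range fun g => ρ g w)) ?_ ?_ c ?_
    · rw [Submodule.ne_bot_iff]
      exact ⟨w, Submodule.subset_span ⟨1, by simp⟩, hw⟩
    · exact Submodule.fg_span (Set.finite_range _)
    · intro n hn
      induction hn using Submodule.span_induction with
      | mem x hx =>
        obtain ⟨h, rfl⟩ := hx
        rw [← hcz]
        simp only [z, LinearMap.sum_apply, LinearMap.smul_apply]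
        refine Submodule.sum_mem _ fun g _ => ?_
        have : ρ.character g⁻¹ • ρ g (ρ h w)
            = (⟨_, isIntegral_character ρ g⁻¹⟩ : A) • ρ (g * h) w := by
          rw [map_mul]; rfl
        rw [this]
        exact Submodule.smul_mem _ _ (Submodule.subset_span ⟨_, rfl⟩)
      | zero => simp
      | add x y _ _ hx hy => rw [smul_add]; exact Submodule.add_mem _ hx hy
      | smul a x _ hx => rw [smul_comm]; exact Submodule.smul_mem _ _ hx
  have hcZ : IsIntegral ℤ c := isIntegral_trans (A := A) c hcA
  have hn : (Module.finrank ℂ U : ℂ) ≠ 0 := by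
    exact_mod_cast (Module.finrank_pos (R := ℂ) (M := U)).ne'
  have hcq : c = algebraMap ℚ ℂ ((Nat.card G : ℚ) / Module.finrank ℂ U) := by
    rw [eq_div_of_mul_eq hn htr]; simp
  rw [hcq, isIntegral_algebraMap_iff (algebraMap ℚ ℂ).injective] at hcZ
  obtain ⟨y, hy⟩ := IsIntegrallyClosed.isIntegral_iff.1 hcZ
  have hnQ : (Module.finrank ℂ U : ℚ) ≠ 0 := by exact_mod_cast hn
  rw [eq_div_iff hnQ, eq_intCast] at hy
  have hyZ : y * Module.finrank ℂ U = (Nat.card G : ℤ) := by exact_mod_cast hy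
  exact Int.natCast_dvd_natCast.1 ⟨y, by rw [← hyZ, mul_comm]⟩

end Representation

/-- A finite group has finitely many irreducible characters. -/
theorem finite_Irr (G : Type*) [Group G] [Finite G] : (Irr G).Finite := by
  classical
  have := Fintype.ofFinite G
  have hne : (Nat.card G : ℂ) ≠ 0 := by exact_mod_cast Nat.card_pos.ne'
  let _ := invertibleOfNonzero hne
  let B : (G → ℂ) →ₗ[ℂ] (G → ℂ) →ₗ[ℂ] ℂ :=
    LinearMap.mk₂ ℂ (fun a b => ∑ g : G, a g * b g⁻¹)
      (by intros; simp [add_mul, Finset.sum_add_distrib])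
      (by intros; simp [Finset.mul_sum, mul_assoc])
      (by intros; simp [mul_add, Finset.sum_add_distrib])
      (by intros; simp [Finset.mul_sum, mul_left_comm])
  have hli : LinearIndependent ℂ (fun χ : Irr G => (χ : G → ℂ)) := by
    refine LinearMap.linearIndependent_of_isOrthoᵢ (B := B) ?_ ?_
    · rintro ⟨χ, n, ρ, hρ, rfl⟩ ⟨χ', n', ρ', hρ', rfl⟩ hne'
      have h := Representation.char_orthonormal ρ ρ'
      rw [if_neg (fun ⟨e⟩ => hne' (Subtype.ext (Representation.char_iso e).symm))] at h
      simpa [hne, B] using h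
    · rintro ⟨χ, n, ρ, hρ, rfl⟩
      have h := Representation.sum_character_mul_character_inv ρ hρ
      simp only [B, LinearMap.mk₂_apply]
      rw [h]
      exact hne
  exact Set.finite_coe_iff.1 hli.finite

/-- The degree of an irreducible character is a positive divisor of the group order. -/
theorem exists_degree_of_mem_Irr {G : Type*} [Group G] [Finite G] {χ : G → ℂ} (hχ : χ ∈ Irr G) :
    ∃ d : ℕ, χ 1 = d ∧ d ∣ Nat.card G := by
  obtain ⟨n, ρ, hρ, rfl⟩ := hχ
  exact ⟨_, ρ.char_one, ρ.finrank_dvd_card hρ⟩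

/-- An irreducible character of degree one is a homomorphism to the multiplicative group. -/
theorem exists_monoidHom_of_mem_Irr_of_apply_one {G : Type*} [Group G] {χ : G → ℂ}
    (hχ : χ ∈ Irr G) (h1 : χ 1 = 1) : ∃ ν : G →* ℂˣ, ∀ g, χ g = ν g := by
  obtain ⟨n, ρ, hρ, rfl⟩ := hχ
  have hn : n = 1 := by
    rw [ρ.char_one] at h1
    simpa using h1
  subst hn
  refine ⟨(LinearMap.det.comp ρ).toHomUnits, fun g => ?_⟩
  simp only [MonoidHom.coe_toHomUnits, MonoidHom.comp_apply, Representation.character]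
  rw [← LinearMap.det_toMatrix', Matrix.det_fin_one,
    LinearMap.trace_eq_matrix_trace ℂ (Pi.basisFun ℂ (Fin 1)), Matrix.trace_fin_one]
  rfl

/-- Orthogonality of linear characters. -/
theorem sum_inv_mul_dual {V : Type*} [Group V] [Fintype V] [DecidableEq (V →* ℂˣ)]
    (μ μ' : V →* ℂˣ) :
    ∑ v, ((μ v : ℂ))⁻¹ * (μ' v : ℂ) = if μ = μ' then (Nat.card V : ℂ) else 0 := by
  split_ifs with h
  · subst h
    simp
  · have := sum_hom_units_eq_zero ((Units.coeHom ℂ).comp (μ⁻¹ * μ')) (fun e => h ?_)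
    · simpa using this
    · have e' : μ⁻¹ * μ' = 1 := by
        ext v
        simpa using congrArg (fun f => f v) e
      exact inv_mul_eq_one.1 e'

section DualAction

variable {G : Type*} [Group G] {V : Subgroup G} [V.Normal]

/-- A group acts by conjugation on the linear characters of a normal subgroup. -/
instance dualMulDistribMulAction : MulDistribMulAction G (V →* ℂˣ) where
  smul g μ := μ.comp (MulAut.conjNormal g⁻¹).toMonoidHom
  one_smul μ := by
    change μ.comp (MulAut.conjNormal (1 : G)⁻¹).toMonoidHom = μ
    ext; simp
  mul_smul g h μ := by
    change μ.comp (MulAut.conjNormal (g * h)⁻¹).toMonoidHom =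
      (μ.comp (MulAut.conjNormal h⁻¹).toMonoidHom).comp (MulAut.conjNormal g⁻¹).toMonoidHom
    ext; simp
  smul_one g := rfl
  smul_mul g μ μ' := rfl

theorem dual_smul_apply (g : G) (μ : V →* ℂˣ) (v : V) :
    (g • μ) v = μ (MulAut.conjNormal g⁻¹ v) := rfl

/-- An abelian normal subgroup acts trivially on its linear characters. -/
theorem coe_smul_dual (hcomm : ∀ v w : V, v * w = w * v) (v : V) (μ : V →* ℂˣ) :
    (v : G) • μ = μ := by
  ext w
  rw [dual_smul_apply]
  congr 2
  apply Subtype.ext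
  have := congrArg (Subtype.val) (hcomm w v)
  simp only [Subgroup.coe_mul] at this
  simp [mul_assoc, this]

end DualAction

section Monomial

variable {G Ω : Type*} [Group G] [MulAction G Ω]

/-- The monomial representation of `G` on functions on the `G`-set `Ω` given by a cocycle `c`. -/
def monomialRep (c : G → Ω → ℂ) (h1 : ∀ ω, c 1 ω = 1)
    (hmul : ∀ g h ω, c (g * h) ω = c g ω * c h (g⁻¹ • ω)) : Representation ℂ G (Ω → ℂ) where
  toFun g :=
    { toFun := fun f ω => c g ω * f (g⁻¹ • ω)
      map_add' := fun _ _ => by ext; simp [mul_add]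
      map_smul' := fun _ _ => by ext; simp [mul_left_comm] }
  map_one' := by ext; simp [h1]
  map_mul' g h := by
    refine LinearMap.ext fun f => funext fun ω => ?_
    simp [hmul, mul_smul, mul_assoc]

variable {c : G → Ω → ℂ} {h1 : ∀ ω, c 1 ω = 1}
  {hmul : ∀ g h ω, c (g * h) ω = c g ω * c h (g⁻¹ • ω)}

theorem monomialRep_apply (g : G) (f : Ω → ℂ) (ω : Ω) :
    monomialRep c h1 hmul g f ω = c g ω * f (g⁻¹ • ω) := rfl

theorem monomialRep_character [Fintype Ω] [DecidableEq Ω] (g : G) :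
    (monomialRep c h1 hmul).character g = ∑ ω, if g • ω = ω then c g ω else 0 := by
  unfold Representation.character
  rw [LinearMap.trace_eq_matrix_trace ℂ (Pi.basisFun ℂ Ω), Matrix.trace]
  refine Finset.sum_congr rfl fun ω _ => ?_
  rw [Matrix.diag_apply, LinearMap.toMatrix_apply]
  simp only [Pi.basisFun_apply, Pi.basisFun_repr, monomialRep_apply, Pi.single_apply,
    inv_smul_eq_iff]
  split_ifs with h h' h'
  · simp
  · exact absurd h.symm h'
  · exact absurd h'.symm h
  · simp

end Monomial

/-- `s` is a projection of `G` onto the normal subgroup `V` along a complement: a crossed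
homomorphism that is the identity on `V`. -/
structure IsCrossedProjection {G : Type*} [Group G] {V : Subgroup G} [V.Normal] (s : G → V) :
    Prop where
  map_mul : ∀ g h, s (g * h) = s g * MulAut.conjNormal g (s h)
  map_coe : ∀ v : V, s v = v

theorem exists_isCrossedProjection {G : Type*} [Group G] {H V : Subgroup G} [V.Normal]
    (hcomm : ∀ v w : V, v * w = w * v) (hsup : H ⊔ V = ⊤) (hinf : H ⊓ V = ⊥) :
    ∃ s : G → V, IsCrossedProjection s := by
  have hex : ∀ g : G, ∃ v : V, (v : G)⁻¹ * g ∈ H := fun g => by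
    have hg : g ∈ V ⊔ H := by rw [sup_comm, hsup]; trivial
    obtain ⟨v, hv, h, hh, rfl⟩ := Subgroup.mem_sup_of_normal_left.1 hg
    exact ⟨⟨v, hv⟩, by simpa using hh⟩
  choose s hs using hex
  have huniq : ∀ g (v : V), (v : G)⁻¹ * g ∈ H → s g = v := by
    intro g v hv
    have h1 : (s g : G)⁻¹ * v ∈ H ⊓ V := by
      refine ⟨?_, V.mul_mem (V.inv_mem (s g).2) v.2⟩
      have := H.mul_mem (hs g) (H.inv_mem hv)
      simpa [mul_assoc] using this
    rw [hinf, Subgroup.mem_bot, inv_mul_eq_one] at h1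
    exact Subtype.ext h1
  refine ⟨s, fun g h => huniq _ _ ?_, fun v => huniq _ _ (by simp)⟩
  have hd := hcomm (MulAut.conjNormal g (s h)) (s g)
  -- conjugation by `g` on `V` agrees with conjugation by its component in the complement
  have key : MulAut.conjNormal g (s h) = MulAut.conjNormal ((s g : G)⁻¹ * g) (s h) := by
    apply Subtype.ext
    rw [map_mul, MulAut.mul_apply, MulAut.conjNormal_apply (s g : G)⁻¹]
    have := congrArg Subtype.val hd
    simp only [Subgroup.coe_mul] at this
    rw [mul_assoc, inv_inv, this, inv_mul_cancel_left]
  have := H.mul_mem (hs g) (hs h)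
  convert this using 1
  rw [key]
  simp only [Subgroup.coe_mul, MulAut.conjNormal_apply]
  group

section OrbitRep

variable {G : Type*} [Group G] {V : Subgroup G} [V.Normal] {s : G → V}

theorem IsCrossedProjection.map_one (hs : IsCrossedProjection s) : s 1 = 1 := hs.map_coe 1

/-- The representation of `G` induced from the extension of `lam` to its stabilizer that is
trivial on the complement, twisted by the linear character `ν`. -/
noncomputable def orbitRep (hs : IsCrossedProjection s) (ν : G →* ℂˣ) (lam : V →* ℂˣ) :
    Representation ℂ G (MulAction.orbit G lam → ℂ) :=
  monomialRep (fun g μ => (ν g : ℂ) * (μ.1 (s g) : ℂ)) (fun μ => by simp [hs.map_one])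
    (fun g h μ => by
      have : (g⁻¹ • μ).1 (s h) = μ.1 (MulAut.conjNormal g (s h)) := by
        change (g⁻¹ • μ.1) (s h) = _
        rw [dual_smul_apply, inv_inv]
      rw [this, hs.map_mul]
      simp only [map_mul, Units.val_mul]
      ring)

theorem orbitRep_apply (hs : IsCrossedProjection s) (ν : G →* ℂˣ) (lam : V →* ℂˣ) (g : G)
    (f : MulAction.orbit G lam → ℂ) (μ : MulAction.orbit G lam) :
    orbitRep hs ν lam g f μ = (ν g : ℂ) * (μ.1 (s g) : ℂ) * f (g⁻¹ • μ) := rfl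

theorem orbitRep_character (hs : IsCrossedProjection s) (ν : G →* ℂˣ) (lam : V →* ℂˣ)
    [Fintype (MulAction.orbit G lam)] [DecidableEq (MulAction.orbit G lam)] (g : G) :
    (orbitRep hs ν lam).character g =
      ∑ μ : MulAction.orbit G lam, if g • μ = μ then (ν g : ℂ) * (μ.1 (s g) : ℂ) else 0 :=
  monomialRep_character g

/-- Twisting by a linear character multiplies the character. -/
theorem orbitRep_character_eq_mul [Finite G] (hs : IsCrossedProjection s) (ν : G →* ℂˣ)
    (lam : V →* ℂˣ) (g : G) :
    (orbitRep hs ν lam).character g = ν g * (orbitRep hs 1 lam).character g := by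
  classical
  have := Fintype.ofFinite (MulAction.orbit G lam)
  rw [orbitRep_character, orbitRep_character, Finset.mul_sum]
  refine Finset.sum_congr rfl fun μ _ => ?_
  split_ifs <;> simp

theorem orbitRep_character_one [Finite G] (hs : IsCrossedProjection s) (ν : G →* ℂˣ)
    (lam : V →* ℂˣ) :
    (orbitRep hs ν lam).character 1 = ((MulAction.stabilizer G lam).index : ℂ) := by
  classical
  have := Fintype.ofFinite (MulAction.orbit G lam)
  rw [Representation.char_one, Module.finrank_fintype_fun_eq_card, MulAction.index_stabilizer,
    ← Nat.card_coe_set_eq, Nat.card_eq_fintype_card]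

theorem orbitRep_isIrreducible [Finite G] (hs : IsCrossedProjection s)
    (hcomm : ∀ v w : V, v * w = w * v) (ν : G →* ℂˣ) (hν : ∀ v : V, ν v = 1) (lam : V →* ℂˣ) :
    (orbitRep hs ν lam).IsIrreducible := by
  classical
  have := Fintype.ofFinite V
  rw [Representation.isIrreducible_iff_forall_invariant]
  have hne : Nonempty (MulAction.orbit G lam) := ⟨⟨lam, MulAction.mem_orbit_self lam⟩⟩
  refine ⟨Function.nontrivial, fun W hW => ?_⟩
  have hVsmul : ∀ (v : V) (μ : MulAction.orbit G lam), (v : G)⁻¹ • μ = μ := fun v μ => by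
    rw [inv_smul_eq_iff]
    exact Subtype.ext (coe_smul_dual hcomm v μ.1).symm
  -- projections to the weight spaces of `V` preserve invariant subspaces
  have hproj : ∀ f ∈ W, ∀ μ : MulAction.orbit G lam, f μ • Pi.single μ (1 : ℂ) ∈ W := by
    intro f hf μ
    have hsum : ∑ v : V, ((μ.1 v : ℂ))⁻¹ • orbitRep hs ν lam v f ∈ W :=
      W.sum_mem fun v _ => W.smul_mem _ (hW _ _ hf)
    have heq : ∑ v : V, ((μ.1 v : ℂ))⁻¹ • orbitRep hs ν lam v f =
        (Nat.card V : ℂ) • (f μ • Pi.single μ (1 : ℂ)) := by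
      funext μ'
      simp only [Finset.sum_apply, Pi.smul_apply, orbitRep_apply, hVsmul, hν, hs.map_coe,
        Units.val_one, one_mul, smul_eq_mul, ← mul_assoc]
      rw [← Finset.sum_mul, sum_inv_mul_dual, Pi.single_apply]
      by_cases h : μ = μ'
      · subst h; simp
      · rw [if_neg (fun e => h (Subtype.ext e)), if_neg (fun e => h e.symm)]; simp
    rw [heq] at hsum
    have hne : (Nat.card V : ℂ) ≠ 0 := by exact_mod_cast Nat.card_pos.ne'
    exact (W.smul_mem_iff hne).1 hsum
  by_cases hbot : W = ⊥
  · exact Or.inl hbot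
  right
  obtain ⟨f, hf, hf0⟩ := (Submodule.ne_bot_iff W).1 hbot
  obtain ⟨μ, hμ⟩ := Function.ne_iff.1 hf0
  have hsingle : Pi.single μ (1 : ℂ) ∈ W := (W.smul_mem_iff hμ).1 (hproj f hf μ)
  have hall : ∀ μ' : MulAction.orbit G lam, Pi.single μ' (1 : ℂ) ∈ W := by
    intro μ'
    obtain ⟨g, rfl⟩ := MulAction.exists_smul_eq G μ μ'
    have h := hproj _ (hW g _ hsingle) (g • μ)
    rw [orbitRep_apply, inv_smul_smul, Pi.single_eq_same, mul_one] at h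
    exact (W.smul_mem_iff (mul_ne_zero (Units.ne_zero _) (Units.ne_zero _))).1 h
  have := Fintype.ofFinite (MulAction.orbit G lam)
  rw [Submodule.eq_top_iff']
  intro x
  rw [← Finset.univ_sum_single x]
  refine W.sum_mem fun μ' _ => ?_
  have := W.smul_mem (x μ') (hall μ')
  rwa [← Pi.single_smul, smul_eq_mul, mul_one] at this

/-- The `lam`-weight of an orbit character at an element of the stabilizer of `lam`. -/
theorem sum_inv_mul_orbitRep_character [Finite G] [Fintype V] (hs : IsCrossedProjection s)
    (hcomm : ∀ v w : V, v * w = w * v) (lam lam' : V →* ℂˣ) (t : G) (ht : t • lam = lam)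
    [Decidable (lam ∈ MulAction.orbit G lam')] :
    ∑ v : V, ((lam v : ℂ))⁻¹ * (orbitRep hs 1 lam').character (v * t) =
      if lam ∈ MulAction.orbit G lam' then (Nat.card V : ℂ) * lam (s t) else 0 := by
  classical
  have := Fintype.ofFinite (MulAction.orbit G lam')
  have hst : ∀ v : V, s (v * t) = v * s t := fun v => by
    rw [hs.map_mul, hs.map_coe]
    congr 1
    apply Subtype.ext
    have := congrArg Subtype.val (hcomm v (s t))
    simp only [Subgroup.coe_mul] at this
    rw [MulAut.conjNormal_apply, this, mul_inv_cancel_right]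
  have hterm : ∀ v : V, ((lam v : ℂ))⁻¹ * (orbitRep hs 1 lam').character (v * t) =
      ∑ μ : MulAction.orbit G lam', (if t • μ = μ then (μ.1 (s t) : ℂ) else 0) *
        (((lam v : ℂ))⁻¹ * (μ.1 v : ℂ)) := fun v => by
    rw [orbitRep_character, Finset.mul_sum]
    refine Finset.sum_congr rfl fun μ _ => ?_
    have : ((v : G) * t) • μ = t • μ := by
      rw [mul_smul]
      exact Subtype.ext (coe_smul_dual hcomm v _)
    rw [this, hst]
    split_ifs
    · simp; ring
    · simp
  rw [Finset.sum_congr rfl fun v _ => hterm v, Finset.sum_comm]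
  simp_rw [← Finset.mul_sum, sum_inv_mul_dual]
  split_ifs with h
  · rw [Finset.sum_eq_single ⟨lam, h⟩]
    · rw [if_pos rfl, if_pos (Subtype.ext ht), mul_comm]
    · intro μ _ hμ
      have : lam ≠ μ.1 := fun e => hμ (Subtype.ext e.symm)
      rw [if_neg this, mul_zero]
    · simp
  · refine Finset.sum_eq_zero fun μ _ => ?_
    have : lam ≠ μ.1 := fun e => h (e ▸ μ.2)
    rw [if_neg this, mul_zero]

end OrbitRep

theorem commutator_le_of_normal_of_prime_index {G : Type*} [Group G] (S : Subgroup G)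
    [S.Normal] (hS : S.index.Prime) : commutator G ≤ S := by
  have := Fact.mk hS
  have hcyc : IsCyclic (G ⧸ S) := isCyclic_of_prime_card (p := S.index) S.index_eq_card.symm
  exact Subgroup.Normal.quotient_commutative_iff_commutator_le.1
    hcyc.isMulCommutative

/-- In a group of odd order, a subgroup of index three is normal. -/
theorem normal_of_index_eq_three_of_odd {G : Type*} [Group G] [Finite G]
    (hodd : Odd (Nat.card G)) (S : Subgroup G) (hS : S.index = 3) : S.Normal := by
  apply Subgroup.normal_of_index_eq_minFac_card
  have h3 : 3 ∣ Nat.card G := hS ▸ S.index_dvd_card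
  have hne : Nat.card G ≠ 1 := fun h => by rw [h] at h3; omega
  have hle := Nat.minFac_le_of_dvd (by norm_num) h3
  have h2 : (Nat.card G).minFac ≠ 2 := fun h => by
    have := (Nat.minFac_eq_two_iff _).1 h
    exact (Nat.not_even_iff_odd.2 hodd) (even_iff_two_dvd.2 this)
  have := (Nat.minFac_prime hne).two_le
  omega

/-- In a group of odd order, a subgroup of index five is normal. -/
theorem normal_of_index_eq_five_of_odd {G : Type*} [Group G] [Finite G]
    (hodd : Odd (Nat.card G)) (S : Subgroup G) (hS : S.index = 5) : S.Normal := by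
  have hdvd : S.normalCore.index ∣ 120 := by
    have : S.normalCore.index ∣ S.index.factorial := by
      rw [Subgroup.normalCore_eq_ker, Subgroup.index_ker, Subgroup.index_eq_card, ← Nat.card_perm]
      exact Subgroup.card_subgroup_dvd_card _
    rwa [hS] at this
  have hoddc : Odd S.normalCore.index := hodd.of_dvd_nat S.normalCore.index_dvd_card
  have hmul : S.normalCore.relIndex S * 5 = S.normalCore.index := by
    rw [← hS]; exact Subgroup.relIndex_mul_index S.normalCore_le
  set r := S.normalCore.relIndex S with hr
  have hr24 : r ∣ 24 := by
    rw [← hmul] at hdvd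
    exact Nat.dvd_of_mul_dvd_mul_right (by norm_num : 0 < 5) hdvd
  have hoddr : Odd r := hoddc.of_dvd_nat ⟨5, hmul.symm⟩
  have hr3 : r ∣ 3 := by
    have hcop : Nat.Coprime r 8 := (Nat.Coprime.pow_right 3
      (Nat.coprime_two_right.2 hoddr) : Nat.Coprime r (2 ^ 3))
    exact hcop.dvd_of_dvd_mul_right (n := 8) (m := 3) hr24
  obtain ⟨n, hn, hrn⟩ := (Nat.dvd_prime_pow Nat.prime_three (m := 1)).1 hr3
  let π := QuotientGroup.mk' S.normalCore
  have hπ : Function.Surjective π := QuotientGroup.mk'_surjective _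
  have hker : π.ker ≤ S := by
    rw [QuotientGroup.ker_mk']; exact S.normalCore_le
  let T := S.map π
  have hTindex : T.index = 5 := by
    rw [Subgroup.index_map_eq S hπ hker, hS]
  have hTcard : Nat.card T = 3 ^ n := by
    rw [← hrn]
    have h1 := T.card_mul_index
    rw [hTindex, ← Subgroup.index_eq_card, ← hmul] at h1
    exact Nat.eq_of_mul_eq_mul_right (by norm_num) h1
  have := Fact.mk Nat.prime_three
  have hmod := Sylow.card_quotient_normalizer_modEq_card_quotient hTcard
  have hT : T.Normal := by
    rw [← Subgroup.normalizer_eq_top_iff]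
    have h5 : T.relIndex (Subgroup.normalizer (T : Set (G ⧸ S.normalCore))) *
        (Subgroup.normalizer (T : Set (G ⧸ S.normalCore))).index = 5 := by
      rw [← hTindex]; exact Subgroup.relIndex_mul_index (Subgroup.le_normalizer (H := T))
    have hrel : T.relIndex (Subgroup.normalizer (T : Set (G ⧸ S.normalCore))) ≡ 5 [MOD 3] := by
      rw [← Subgroup.index_eq_card T, hTindex] at hmod
      exact hmod
    rcases (Nat.dvd_prime Nat.prime_five).1 (Dvd.intro _ h5) with h | h
    · rw [h] at hrel; exact absurd hrel (by decide)
    · rw [h] at h5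
      exact Subgroup.index_eq_one.1 (by omega)
  have hcomap : S = T.comap π := by
    rw [Subgroup.comap_map_eq_self hker]
  rw [hcomap]
  exact hT.comap π

theorem commutator_le_of_index_of_odd {G : Type*} [Group G] [Finite G]
    (hodd : Odd (Nat.card G)) (S : Subgroup G) (hS : S.index = 3 ∨ S.index = 5) :
    commutator G ≤ S := by
  rcases hS with hS | hS
  · have := normal_of_index_eq_three_of_odd hodd S hS
    exact commutator_le_of_normal_of_prime_index S (by rw [hS]; exact Nat.prime_three)
  · have := normal_of_index_eq_five_of_odd hodd S hS
    exact commutator_le_of_normal_of_prime_index S (by rw [hS]; exact Nat.prime_five)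

/-- In a group of odd order, a subgroup `S` that does not contain the commutator subgroup has
index `a * b`, where `a` is the index of `commutator G ⊔ S`, with restrictions on small values. -/
theorem exists_index_eq_mul_of_odd {G : Type*} [Group G] [Finite G]
    (hodd : Odd (Nat.card G)) (S : Subgroup G) (hS : ¬ commutator G ≤ S) :
    ∃ b, S.index = (commutator G ⊔ S).index * b ∧ b ≠ 1 ∧ Odd (commutator G ⊔ S).index ∧ Odd b ∧
      ((commutator G ⊔ S).index = 1 → b ≠ 3 ∧ b ≠ 5) := by
  have hmul : S.index = (commutator G ⊔ S).index * S.relIndex (commutator G ⊔ S) := by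
    rw [mul_comm]; exact (Subgroup.relIndex_mul_index le_sup_right).symm
  have hoddS : Odd S.index := hodd.of_dvd_nat S.index_dvd_card
  refine ⟨_, hmul, ?_, hoddS.of_dvd_nat ⟨_, hmul⟩, hoddS.of_dvd_nat (Dvd.intro_left _ hmul.symm), ?_⟩
  · intro h
    exact hS (le_sup_left.trans (Subgroup.relIndex_eq_one.1 h))
  · intro h
    rw [h, one_mul] at hmul
    rw [← hmul]
    exact ⟨fun h3 => hS (commutator_le_of_index_of_odd hodd S (Or.inl h3)),
      fun h5 => hS (commutator_le_of_index_of_odd hodd S (Or.inr h5))⟩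

theorem finite_monoidHom_quotient_and_card_eq {G : Type*} [Group G] [Finite G] (D : Subgroup G)
    [D.Normal] (hD : commutator G ≤ D) :
    Finite (G ⧸ D →* ℂˣ) ∧ Nat.card (G ⧸ D →* ℂˣ) = D.index := by
  let _ : CommGroup (G ⧸ D) :=
    { (inferInstance : Group (G ⧸ D)) with
      mul_comm := fun a b =>
        (Subgroup.Normal.quotient_commutative_iff_commutator_le.2 hD).is_comm.comm a b }
  have : NeZero (Monoid.exponent (G ⧸ D)) := ⟨Monoid.exponent_ne_zero_of_finite⟩
  have hc := CommGroup.card_monoidHom_of_hasEnoughRootsOfUnity (G ⧸ D) ℂ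
  have hpos : 0 < Nat.card (G ⧸ D →* ℂˣ) := by rw [hc]; exact Nat.card_pos
  exact ⟨Nat.finite_of_card_ne_zero hpos.ne', hc.trans D.index_eq_card.symm⟩

/-- There are at most `[G : D]` linear characters of `G` with a given restriction to a subgroup
`D` containing the commutator subgroup. -/
theorem card_le_index_of_forall_eq_on {G : Type*} [Group G] [Finite G] (D : Subgroup G)
    (hD : commutator G ≤ D) (A : Finset (G → ℂ)) (hA : ∀ χ ∈ A, ∃ ν : G →* ℂˣ, ∀ g, χ g = ν g)
    (hAD : ∀ χ ∈ A, ∀ χ' ∈ A, ∀ g ∈ D, χ g = χ' g) : A.card ≤ D.index := by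
  have hDn : D.Normal := Subgroup.Normal.of_commutator_le G hD
  rcases A.eq_empty_or_nonempty with rfl | ⟨χ₀, hχ₀⟩
  · simp
  obtain ⟨hfin, hcard⟩ := finite_monoidHom_quotient_and_card_eq D hD
  obtain ⟨ν₀, hν₀⟩ := hA χ₀ hχ₀
  have hex : ∀ χ : A, ∃ φ : G ⧸ D →* ℂˣ, ∀ g : G, χ.1 g = (φ g : ℂ) * χ₀ g := by
    rintro ⟨χ, hχ⟩
    obtain ⟨ν, hν⟩ := hA χ hχ
    refine ⟨QuotientGroup.lift D (ν * ν₀⁻¹) fun g hg => ?_, fun g => ?_⟩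
    · have h := hAD χ hχ χ₀ hχ₀ g hg
      rw [hν, hν₀] at h
      simp [Units.ext h]
    · rw [QuotientGroup.lift_mk]
      simp [hν, hν₀]
  choose φ hφ using hex
  have hinj : Function.Injective φ := fun χ χ' h => by
    apply Subtype.ext
    funext g
    rw [hφ, hφ, h]
  rw [← hcard, ← Nat.card_eq_finsetCard A]
  exact Nat.card_le_card_of_injective φ hinj

section DualStabilizer

variable {G : Type*} [Group G] {V : Subgroup G} [V.Normal]

theorem dual_smul_inv (g : G) (μ : V →* ℂˣ) : g • μ⁻¹ = (g • μ)⁻¹ := rfl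

theorem stabilizer_dual_inv (lam : V →* ℂˣ) :
    MulAction.stabilizer G lam⁻¹ = MulAction.stabilizer G lam := by
  ext g
  rw [MulAction.mem_stabilizer_iff, MulAction.mem_stabilizer_iff, dual_smul_inv]
  exact inv_inj (G := V →* ℂˣ)

/-- In a group of odd order, a nontrivial linear character of a normal subgroup is not conjugate
to its inverse. -/
theorem notMem_orbit_inv_of_odd [Finite G] (hodd : Odd (Nat.card G)) {lam : V →* ℂˣ}
    (hlam : lam ≠ 1) : lam ∉ MulAction.orbit G lam⁻¹ := by
  rintro ⟨g, hg⟩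
  obtain ⟨m, hm⟩ := hodd
  replace hg : g • lam⁻¹ = lam := hg
  have hg' : g • lam = lam⁻¹ := 
    (inv_eq_iff_eq_inv (G := V →* ℂˣ)).1 ((dual_smul_inv g lam).symm.trans hg)
  have hg2 : g ^ 2 ∈ MulAction.stabilizer G lam := by
    rw [MulAction.mem_stabilizer_iff, sq, mul_smul, hg', hg]
  have hgpow : (g ^ 2) ^ (m + 1) = g := by
    have : g ^ Nat.card G = 1 := pow_card_eq_one'
    rw [hm] at this
    rw [← pow_mul, show 2 * (m + 1) = 2 * m + 1 + 1 by ring, pow_succ, this, one_mul]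
  have hstab := (MulAction.stabilizer G lam).pow_mem hg2 (m + 1)
  rw [hgpow, MulAction.mem_stabilizer_iff, hg'] at hstab
  refine hlam (MonoidHom.ext fun v => ?_)
  have h2 : lam v ^ 2 = 1 := by
    rw [sq]
    nth_rewrite 1 [← hstab]
    simp
  have hv : v ^ Nat.card G = 1 := Subtype.ext (by
    rw [Subgroup.coe_pow, pow_card_eq_one', Subgroup.coe_one])
  have h3 : lam v ^ Nat.card G = 1 := by rw [← map_pow, hv, map_one]
  rw [hm, pow_succ, pow_mul, h2, one_pow, one_mul] at h3
  exact h3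

end DualStabilizer

namespace IsFaithfulIrreducibleModule

variable {G : Type*} [Group G] {p : ℕ} {H V : Subgroup G}

theorem exists_not_commute (hV : IsFaithfulIrreducibleModule p H V)
    (hH : ¬ ∀ x ∈ H, ∀ y ∈ H, x * y = y * x) : ∃ h ∈ H, ∃ v ∈ V, h * v * h⁻¹ ≠ v := by
  by_contra hcon
  push Not at hcon
  refine hH fun x hx y hy => ?_
  rw [hV.faithful x hx (hcon x hx), hV.faithful y hy (hcon y hy)]

/-- A linear character of `G` is trivial on a noncentral irreducible module. -/
theorem monoidHom_apply_eq_one (hV : IsFaithfulIrreducibleModule p H V)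
    (hH : ¬ ∀ x ∈ H, ∀ y ∈ H, x * y = y * x) (ν : G →* ℂˣ) (v : G) (hv : v ∈ V) : ν v = 1 := by
  have hnorm := hV.normal
  rcases hV.irreducible (V ⊓ ν.ker) inf_le_left
    (fun h _ w hw => (inferInstance : (V ⊓ ν.ker).Normal).conj_mem w hw h) with hW | hW
  · exfalso
    obtain ⟨h, -, v, hv, hne⟩ := hV.exists_not_commute hH
    have hmem : h * v * h⁻¹ * v⁻¹ ∈ V ⊓ ν.ker := by
      refine ⟨V.mul_mem (hnorm.conj_mem v hv h) (V.inv_mem hv), ?_⟩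
      change ν _ = 1
      simp only [map_mul, map_inv]
      rw [mul_right_comm (ν h), mul_inv_cancel, one_mul, mul_inv_cancel]
    rw [hW, Subgroup.mem_bot, mul_inv_eq_one] at hmem
    exact hne hmem
  · have : v ∈ V ⊓ ν.ker := by rw [hW]; exact hv
    exact this.2

/-- The commutator subgroup moves every nontrivial linear character of `V`. -/
theorem not_commutator_le_stabilizer [V.Normal] (hV : IsFaithfulIrreducibleModule p H V)
    (hH : ¬ ∀ x ∈ H, ∀ y ∈ H, x * y = y * x) {lam : V →* ℂˣ} (hlam : lam ≠ 1) :
    ¬ commutator G ≤ MulAction.stabilizer G lam := by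
  intro hle
  let K : Subgroup V :=
    ⨅ μ : {μ : V →* ℂˣ // commutator G ≤ MulAction.stabilizer G μ}, μ.1.ker
  have hK : ∀ v : V, v ∈ K ↔
      ∀ μ : V →* ℂˣ, commutator G ≤ MulAction.stabilizer G μ → μ v = 1 := fun v => by
    simp [K, Subgroup.mem_iInf, MonoidHom.mem_ker]
  have hinv : ∀ h ∈ H, ∀ w ∈ K.map V.subtype, h * w * h⁻¹ ∈ K.map V.subtype := by
    rintro h - _ ⟨w, hw, rfl⟩
    refine ⟨MulAut.conjNormal h w, ?_, MulAut.conjNormal_apply h w⟩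
    rw [SetLike.mem_coe, hK] at hw ⊢
    intro μ hμ
    have := hw (h⁻¹ • μ) fun d hd => by
      rw [MulAction.mem_stabilizer_iff]
      have hd' := hμ ((inferInstance : (commutator G).Normal).conj_mem d hd h)
      rw [MulAction.mem_stabilizer_iff, mul_smul, mul_smul] at hd'
      rw [eq_inv_smul_iff, hd']
    rwa [dual_smul_apply, inv_inv] at this
  have hKle : K.map V.subtype ≤ V := by
    rintro _ ⟨w, -, rfl⟩
    exact w.2
  rcases hV.irreducible _ hKle hinv with hW | hW
  · rw [Subgroup.map_eq_bot_iff_of_injective _ V.subtype_injective] at hW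
    have hcent : ∀ d ∈ commutator G, ∀ v ∈ V, d * v * d⁻¹ = v := by
      intro d hd v hv
      have hmem : MulAut.conjNormal d ⟨v, hv⟩ * (⟨v, hv⟩ : V)⁻¹ ∈ K := by
        rw [hK]
        intro μ hμ
        have := hμ ((commutator G).inv_mem hd)
        rw [MulAction.mem_stabilizer_iff] at this
        have h' := congrArg (fun μ' => μ' ⟨v, hv⟩) this
        simp only [dual_smul_apply, inv_inv] at h'
        rw [map_mul, h', map_inv, mul_inv_cancel]
      rw [hW, Subgroup.mem_bot, mul_inv_eq_one] at hmem
      exact congrArg Subtype.val hmem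
    refine hH fun x hx y hy => ?_
    rw [← commutatorElement_eq_one_iff_mul_comm]
    refine hV.faithful _ ?_ (hcent _ ?_)
    · rw [commutatorElement_def]
      exact H.mul_mem (H.mul_mem (H.mul_mem hx hy) (H.inv_mem hx)) (H.inv_mem hy)
    · exact Subgroup.commutator_mem_commutator (Subgroup.mem_top x) (Subgroup.mem_top y)
  · refine hlam (MonoidHom.ext fun v => ?_)
    have hv : (v : G) ∈ K.map V.subtype := by rw [hW]; exact v.2
    obtain ⟨w, hw, hwv⟩ := hv
    obtain rfl : w = v := Subtype.ext hwv
    exact (hK w).1 hw lam hle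

theorem card_dual [Finite G] (hV : IsFaithfulIrreducibleModule p H V) :
    Nat.card (V →* ℂˣ) = Nat.card V := by
  let _ : CommGroup V :=
    { (inferInstance : Group V) with
      mul_comm := fun a b => Subtype.ext (hV.comm a a.2 b b.2) }
  have : NeZero (Monoid.exponent V) := ⟨Monoid.exponent_ne_zero_of_finite⟩
  exact CommGroup.card_monoidHom_of_hasEnoughRootsOfUnity V ℂ

/-- Some nontrivial linear character of `V` is fixed by a Sylow `p`-subgroup. -/
theorem exists_not_dvd_index_stabilizer [Finite G] [V.Normal] (hp : p.Prime)
    (hV : IsFaithfulIrreducibleModule p H V) :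
    ∃ lam : V →* ℂˣ, lam ≠ 1 ∧ ¬ p ∣ (MulAction.stabilizer G lam).index := by
  have := Fact.mk hp
  have hdvd : p ∣ Nat.card (V →* ℂˣ) := by
    rw [hV.card_dual]
    obtain ⟨⟨v, hv⟩, hv1'⟩ := Subgroup.ne_bot_iff_exists_ne_one.1 hV.ne_bot
    have hv1 : v ≠ 1 := fun h => hv1' (Subtype.ext h)
    have ho : orderOf v = p := orderOf_eq_prime (hV.pow_eq_one v hv) hv1
    rw [← ho]
    exact Subgroup.orderOf_dvd_natCard V hv
  obtain ⟨P⟩ := (inferInstance : Nonempty (Sylow p G))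
  have hone : (1 : V →* ℂˣ) ∈ MulAction.fixedPoints P (V →* ℂˣ) := fun _ => rfl
  obtain ⟨lam, hfix, hne⟩ :=
    P.isPGroup'.exists_fixed_point_of_prime_dvd_card_of_fixed_point (V →* ℂˣ) hdvd hone
  refine ⟨lam, hne.symm, fun h => P.not_dvd_index (h.trans (Subgroup.index_dvd_of_le ?_))⟩
  exact fun g hg => hfix ⟨g, hg⟩

end IsFaithfulIrreducibleModule

/-- If the elements of `L` have degree one, those of `A` and `B` have degree `d`, and all elements
outside `L` have degree at least `c`, then `A` and `B` can compensate `L` in the average. -/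
theorem mul_card_le_sum_of_compensation {α : Type*} [DecidableEq α] (F L A B : Finset α)
    (deg : α → ℝ) (c d : ℝ) (hL : L ⊆ F) (hA : A ⊆ F) (hB : B ⊆ F) (hLA : Disjoint L A)
    (hLB : Disjoint L B) (hAB : Disjoint A B) (hdegL : ∀ x ∈ L, deg x = 1)
    (hdegA : ∀ x ∈ A, deg x = d) (hdegB : ∀ x ∈ B, deg x = d)
    (hdeg : ∀ x ∈ F, x ∉ L → c ≤ deg x)
    (hnum : (c - 1) * L.card ≤ ((A.card : ℝ) + B.card) * (d - c)) :
    c * F.card ≤ ∑ x ∈ F, deg x := by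
  have hsub : A ∪ B ⊆ F \ L := by
    intro x hx
    rw [Finset.mem_sdiff]
    rcases Finset.mem_union.1 hx with h | h
    · exact ⟨hA h, Finset.disjoint_right.1 hLA h⟩
    · exact ⟨hB h, Finset.disjoint_right.1 hLB h⟩
  have h1 : ∑ x ∈ A ∪ B, (deg x - c) ≤ ∑ x ∈ F \ L, (deg x - c) :=
    Finset.sum_le_sum_of_subset_of_nonneg hsub fun x hx _ => by
      rw [Finset.mem_sdiff] at hx
      linarith [hdeg x hx.1 hx.2]
  rw [Finset.sum_union hAB, Finset.sum_congr rfl fun x hx => by rw [hdegA x hx],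
    Finset.sum_congr (s₁ := B) rfl fun x hx => by rw [hdegB x hx]] at h1
  have h2 : ∑ x ∈ F \ L, (deg x - c) + ∑ x ∈ L, (deg x - c) = ∑ x ∈ F, (deg x - c) :=
    Finset.sum_sdiff hL
  have h3 : ∑ x ∈ L, (deg x - c) = L.card * (1 - c) := by
    rw [Finset.sum_congr rfl fun x hx => by rw [hdegL x hx], Finset.sum_const, nsmul_eq_mul]
  have h4 : ∑ x ∈ F, (deg x - c) = ∑ x ∈ F, deg x - F.card * c := by
    rw [Finset.sum_sub_distrib]; simp
  simp only [Finset.sum_const, nsmul_eq_mul] at h1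
  nlinarith

section OrbitCharacters

variable {G : Type*} [Group G] [Finite G] {V : Subgroup G} [V.Normal] {s : G → V}

theorem orbitRep_character_mem_IrrKP' (hs : IsCrossedProjection s)
    (hcomm : ∀ v w : V, v * w = w * v) {p : ℕ} (hp : p.Prime) (hpow : ∀ v : V, v ^ p = 1)
    (k : Subfield ℂ) (hk : ∃ ζ ∈ k, IsPrimitiveRoot ζ p) (ν : G →* ℂˣ) (hν : ∀ v : V, ν v = 1)
    (hνk : ∀ g, (ν g : ℂ) ∈ k) (lam : V →* ℂˣ)
    (hlam : ¬ p ∣ (MulAction.stabilizer G lam).index) :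
    (orbitRep hs ν lam).character ∈ IrrKP' k p G := by
  classical
  refine ⟨Representation.character_mem_Irr _ (orbitRep_isIrreducible hs hcomm ν hν lam),
    fun g => ?_, _, orbitRep_character_one hs ν lam, hlam⟩
  have := Fintype.ofFinite (MulAction.orbit G lam)
  rw [orbitRep_character]
  refine k.sum_mem fun μ _ => ?_
  split_ifs
  · refine k.mul_mem (hνk g) ?_
    obtain ⟨ζ, hζk, hζ⟩ := hk
    have : NeZero p := ⟨hp.ne_zero⟩
    have h1 : ((μ.1 (s g) : ℂˣ) : ℂ) ^ p = 1 := by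
      rw [← Units.val_pow_eq_pow_val, ← map_pow, hpow, map_one, Units.val_one]
    obtain ⟨i, -, hi⟩ := hζ.eq_pow_of_pow_eq_one h1
    rw [← hi]
    exact k.pow_mem hζk i
  · exact k.zero_mem

/-- Linear characters giving the same twist of an orbit character agree on the stabilizer. -/
theorem eq_on_stabilizer_of_mul_orbitRep_character_eq (hs : IsCrossedProjection s)
    (hcomm : ∀ v w : V, v * w = w * v) (lam : V →* ℂˣ) (ν ν' : G →* ℂˣ)
    (hν : ∀ v : V, ν v = 1) (hν' : ∀ v : V, ν' v = 1)
    (h : ∀ g, (ν g : ℂ) * (orbitRep hs 1 lam).character g =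
      ν' g * (orbitRep hs 1 lam).character g) (t : G) (ht : t ∈ MulAction.stabilizer G lam) :
    ν t = ν' t := by
  classical
  have := Fintype.ofFinite V
  have hsum := sum_inv_mul_orbitRep_character hs hcomm lam lam t ht
  rw [if_pos (MulAction.mem_orbit_self lam)] at hsum
  have hne : (Nat.card V : ℂ) * lam (s t) ≠ 0 :=
    mul_ne_zero (by exact_mod_cast Nat.card_pos.ne') (Units.ne_zero _)
  apply Units.ext
  apply mul_right_cancel₀ hne
  rw [← hsum, Finset.mul_sum, Finset.mul_sum]
  refine Finset.sum_congr rfl fun v _ => ?_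
  have := h (v * t)
  rw [map_mul, map_mul, hν, hν', one_mul, one_mul] at this
  rw [mul_left_comm, this, mul_left_comm]

/-- Twists of orbit characters of different orbits are different. -/
theorem mul_orbitRep_character_ne (hs : IsCrossedProjection s)
    (hcomm : ∀ v w : V, v * w = w * v) {lam lam' : V →* ℂˣ}
    (hlam : lam ∉ MulAction.orbit G lam') (ν ν' : G →* ℂˣ)
    (hν : ∀ v : V, ν v = 1) (hν' : ∀ v : V, ν' v = 1) :
    ¬ ∀ g, (ν g : ℂ) * (orbitRep hs 1 lam).character g =
      ν' g * (orbitRep hs 1 lam').character g := by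
  classical
  intro h
  have := Fintype.ofFinite V
  have h1 := sum_inv_mul_orbitRep_character hs hcomm lam lam 1 (one_smul _ _)
  have h2 := sum_inv_mul_orbitRep_character hs hcomm lam lam' 1 (one_smul _ _)
  rw [if_pos (MulAction.mem_orbit_self lam)] at h1
  rw [if_neg hlam] at h2
  have hne : (Nat.card V : ℂ) * lam (s 1) ≠ 0 :=
    mul_ne_zero (by exact_mod_cast Nat.card_pos.ne') (Units.ne_zero _)
  rw [← h1, ← h2] at hne
  refine hne (Finset.sum_congr rfl fun v _ => ?_)
  have := h v
  rw [hν, hν', Units.val_one, one_mul, one_mul] at this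
  rw [mul_one, this]

/-- The twists of an orbit character by a set `L` of linear characters of `G` number at least
`L.card` divided by the index of `commutator G ⊔ stabilizer`. -/
theorem card_le_index_mul_card_image_twist [DecidableEq (G → ℂ)] (hs : IsCrossedProjection s)
    (hcomm : ∀ v w : V, v * w = w * v) (lam : V →* ℂˣ) (L : Finset (G → ℂ))
    (hL : ∀ χ ∈ L, ∃ ν : G →* ℂˣ, (∀ v : V, ν v = 1) ∧ ∀ g, χ g = ν g) :
    L.card ≤ (commutator G ⊔ MulAction.stabilizer G lam).index *
      (L.image fun χ => χ * (orbitRep hs 1 lam).character).card := by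
  refine Finset.card_le_mul_card_image L _ fun ψ _ => ?_
  refine card_le_index_of_forall_eq_on _ le_sup_left _ (fun χ hχ => ?_) fun χ hχ χ' hχ' => ?_
  · obtain ⟨ν, -, h⟩ := hL χ (Finset.mem_filter.1 hχ).1
    exact ⟨ν, h⟩
  · rw [Finset.mem_filter] at hχ hχ'
    obtain ⟨ν, hν, hχν⟩ := hL χ hχ.1
    obtain ⟨ν', hν', hχν'⟩ := hL χ' hχ'.1
    have heq : ∀ t ∈ MulAction.stabilizer G lam, ν t = ν' t := by
      refine eq_on_stabilizer_of_mul_orbitRep_character_eq hs hcomm lam ν ν' hν hν' fun g => ?_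
      rw [← hχν, ← hχν']
      exact congrFun (hχ.2.trans hχ'.2.symm) g
    have hle : commutator G ⊔ MulAction.stabilizer G lam ≤ (ν * ν'⁻¹).ker :=
      sup_le (Abelianization.commutator_subset_ker _) fun t ht => by
        rw [MonoidHom.mem_ker, MonoidHom.mul_apply, heq t ht]
        exact mul_inv_cancel _
    intro g hg
    have hg' : ν g * (ν' g)⁻¹ = 1 := hle hg
    rw [hχν, hχν', mul_inv_eq_one.1 hg']

end OrbitCharacters

/-- Reduction of the lower bound `c` for the average to an inequality between indices. -/
theorem le_acdKP'_of_index_bound {G : Type*} [Group G] [Finite G] (hodd : Odd (Nat.card G))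
    {p : ℕ} (hp : p.Prime) {H V : Subgroup G} (hsup : H ⊔ V = ⊤) (hinf : H ⊓ V = ⊥)
    (hV : IsFaithfulIrreducibleModule p H V) (hH : ¬ ∀ x ∈ H, ∀ y ∈ H, x * y = y * x)
    (k : Subfield ℂ) (hk : ∃ ζ ∈ k, IsPrimitiveRoot ζ p) (c : ℝ) (hc : 1 ≤ c)
    (hdeg : ∀ n : ℕ, Odd n → ¬ p ∣ n → n ≠ 1 → c ≤ n)
    (hab : ∀ a b : ℕ, Odd a → Odd b → ¬ p ∣ a * b → b ≠ 1 → (a = 1 → b ≠ 3 ∧ b ≠ 5) →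
      (c - 1) / 2 * a ≤ a * b - c) :
    c ≤ acdKP' k p G := by
  classical
  have hnorm := hV.normal
  have hcomm : ∀ v w : V, v * w = w * v := fun v w => Subtype.ext (hV.comm v v.2 w w.2)
  have hpow : ∀ v : V, v ^ p = 1 := fun v => Subtype.ext (hV.pow_eq_one v v.2)
  obtain ⟨s, hs⟩ := exists_isCrossedProjection hcomm hsup hinf
  obtain ⟨lam, hlam, hplam⟩ := hV.exists_not_dvd_index_stabilizer hp
  have hpinv : ¬ p ∣ (MulAction.stabilizer G lam⁻¹).index := by rwa [stabilizer_dual_inv]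
  obtain ⟨b, hidx, hb1, hodda, hoddb, hsmall⟩ :=
    exists_index_eq_mul_of_odd hodd _ (hV.not_commutator_le_stabilizer hH hlam)
  set a := (commutator G ⊔ MulAction.stabilizer G lam).index with ha
  have hineq := hab a b hodda hoddb (hidx ▸ hplam) hb1 hsmall
  have hfin : (IrrKP' k p G).Finite := (finite_Irr G).subset fun χ hχ => hχ.1
  let F := hfin.toFinset
  have hF : ∀ χ, χ ∈ F ↔ χ ∈ IrrKP' k p G := fun χ => hfin.mem_toFinset
  let L := F.filter fun χ => χ 1 = 1
  have hL : ∀ χ ∈ L, ∃ ν : G →* ℂˣ, (∀ v : V, ν v = 1) ∧ ∀ g, χ g = ν g := by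
    intro χ hχ
    rw [Finset.mem_filter, hF] at hχ
    obtain ⟨ν, hν⟩ := exists_monoidHom_of_mem_Irr_of_apply_one hχ.1.1 hχ.2
    exact ⟨ν, fun v => hV.monoidHom_apply_eq_one hH ν v v.2, hν⟩
  let tw (μ : V →* ℂˣ) : Finset (G → ℂ) := L.image fun χ => χ * (orbitRep hs 1 μ).character
  have htw : ∀ μ : V →* ℂˣ, ¬ p ∣ (MulAction.stabilizer G μ).index → tw μ ⊆ F := by
    intro μ hμ χ' hχ'
    obtain ⟨χ, hχ, rfl⟩ := Finset.mem_image.1 hχ'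
    obtain ⟨ν, hν, hχν⟩ := hL χ hχ
    have hχF := (hF χ).1 (Finset.mem_filter.1 hχ).1
    rw [hF]
    convert orbitRep_character_mem_IrrKP' hs hcomm hp hpow k hk ν hν
      (fun g => hχν g ▸ hχF.2.1 g) μ hμ using 1
    funext g
    rw [orbitRep_character_eq_mul, Pi.mul_apply, hχν]
  have htwdeg : ∀ μ : V →* ℂˣ, ∀ χ ∈ tw μ, χ 1 = ((MulAction.stabilizer G μ).index : ℂ) := by
    intro μ χ' hχ'
    obtain ⟨χ, hχ, rfl⟩ := Finset.mem_image.1 hχ'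
    rw [Pi.mul_apply, (Finset.mem_filter.1 hχ).2, one_mul, orbitRep_character_one]
  have hidx1 : (MulAction.stabilizer G lam).index ≠ 1 := by
    rw [hidx]
    exact fun h => hb1 (Nat.eq_one_of_mul_eq_one_left h)
  have hdisjL : ∀ μ : V →* ℂˣ, (MulAction.stabilizer G μ).index ≠ 1 → Disjoint L (tw μ) := by
    intro μ hμ
    rw [Finset.disjoint_left]
    intro χ hχ hχ'
    have h1 := htwdeg μ χ hχ'
    rw [(Finset.mem_filter.1 hχ).2] at h1
    exact hμ (by exact_mod_cast h1.symm)
  have hdisj : Disjoint (tw lam) (tw lam⁻¹) := by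
    rw [Finset.disjoint_left]
    intro ψ hψ hψ'
    obtain ⟨χ, hχ, rfl⟩ := Finset.mem_image.1 hψ
    obtain ⟨χ', hχ', he⟩ := Finset.mem_image.1 hψ'
    obtain ⟨ν, hν, hχν⟩ := hL χ hχ
    obtain ⟨ν', hν', hχν'⟩ := hL χ' hχ'
    refine mul_orbitRep_character_ne hs hcomm (notMem_orbit_inv_of_odd hodd hlam) ν ν' hν hν'
      fun g => ?_
    rw [← hχν, ← hχν']
    exact (congrFun he g).symm
  have hcard1 : L.card ≤ a * (tw lam).card :=
    card_le_index_mul_card_image_twist hs hcomm lam L hL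
  have hcard2 : L.card ≤ a * (tw lam⁻¹).card := by
    have := card_le_index_mul_card_image_twist hs hcomm lam⁻¹ L hL
    rwa [stabilizer_dual_inv] at this
  have hFne : F.Nonempty := ⟨_, (hF _).2 (orbitRep_character_mem_IrrKP' hs hcomm hp hpow k hk 1
    (fun _ => rfl) (fun _ => by simp) lam hplam)⟩
  have hmain : c * F.card ≤ ∑ χ ∈ F, (χ 1).re := by
    refine mul_card_le_sum_of_compensation F L (tw lam) (tw lam⁻¹) _ c (a * b)
      (Finset.filter_subset _ _) (htw lam hplam) (htw lam⁻¹ hpinv) (hdisjL lam hidx1)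
      (hdisjL lam⁻¹ (by rwa [stabilizer_dual_inv])) hdisj ?_ ?_ ?_ ?_ ?_
    · intro χ hχ
      rw [(Finset.mem_filter.1 hχ).2, Complex.one_re]
    · intro χ hχ
      rw [htwdeg lam χ hχ, hidx]
      simp
    · intro χ hχ
      rw [htwdeg lam⁻¹ χ hχ, stabilizer_dual_inv, hidx]
      simp
    · intro χ hχ hχL
      obtain ⟨hirr, -, d, hd, hpd⟩ := (hF χ).1 hχ
      obtain ⟨d', hd', hdvd⟩ := exists_degree_of_mem_Irr hirr
      obtain rfl : d = d' := by
        rw [hd] at hd'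
        exact_mod_cast hd'
      rw [hd, Complex.natCast_re]
      refine hdeg d (hodd.of_dvd_nat hdvd) hpd ?_
      rintro rfl
      exact hχL (Finset.mem_filter.2 ⟨hχ, by rw [hd, Nat.cast_one]⟩)
    · have h1 : (L.card : ℝ) ≤ a * (tw lam).card := by exact_mod_cast hcard1
      have h2 : (L.card : ℝ) ≤ a * (tw lam⁻¹).card := by exact_mod_cast hcard2
      have hN : (0 : ℝ) ≤ (tw lam).card + (tw lam⁻¹).card := by positivity
      calc (c - 1) * (L.card : ℝ)
          ≤ (c - 1) * (a * ((tw lam).card + (tw lam⁻¹).card) / 2) :=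
            mul_le_mul_of_nonneg_left (by linarith) (by linarith)
        _ = ((tw lam).card + (tw lam⁻¹).card) * ((c - 1) / 2 * a) := by ring
        _ ≤ _ := mul_le_mul_of_nonneg_left hineq hN
  have hsum : ∑ᶠ χ ∈ IrrKP' k p G, (χ 1).re = ∑ χ ∈ F, (χ 1).re :=
    finsum_mem_eq_finite_toFinset_sum _ hfin
  rw [acdKP', hsum, Set.ncard_eq_toFinset_card _ hfin,
    le_div_iff₀ (by exact_mod_cast hFne.card_pos)]
  exact hmain

theorem lemma4p3 {G : Type*} [Group G] [Finite G] (hodd : Odd (Nat.card G))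
    (p : ℕ) (hp : p.Prime) (H V : Subgroup G)
    (hsup : H ⊔ V = ⊤) (hinf : H ⊓ V = ⊥)
    (hV : IsFaithfulIrreducibleModule p H V)
    (hH : ¬ ∀ x ∈ H, ∀ y ∈ H, x * y = y * x)
    (k : Subfield ℂ) (hk : ∃ ζ ∈ k, IsPrimitiveRoot ζ p) :
    (p ≠ 3 → 3 ≤ acdKP' k p G) ∧ (p = 3 → 81 / 17 ≤ acdKP' k 3 G) := by
  constructor
  · intro _
    refine le_acdKP'_of_index_bound hodd hp hsup hinf hV hH k hk 3 (by norm_num) ?_ ?_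
    · intro n hn _ hn1
      obtain ⟨m, rfl⟩ := hn
      have : 3 ≤ 2 * m + 1 := by omega
      exact_mod_cast this
    · intro a b hoa hob _ hb1 hsmall
      have hnat : a + 3 ≤ a * b := by
        obtain ⟨i, rfl⟩ := hoa
        obtain ⟨j, rfl⟩ := hob
        rcases Nat.eq_zero_or_pos i with rfl | hi
        · have := hsmall rfl
          omega
        · have : 1 ≤ j := by omega
          nlinarith
      have : (a : ℝ) + 3 ≤ a * b := by exact_mod_cast hnat
      linarith
  · rintro rfl
    refine le_acdKP'_of_index_bound hodd hp hsup hinf hV hH k hk (81 / 17) (by norm_num) ?_ ?_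
    · intro n hn hn3 hn1
      have : 5 ≤ n := by
        obtain ⟨m, rfl⟩ := hn
        omega
      have : (5 : ℝ) ≤ n := by exact_mod_cast this
      linarith
    · intro a b hoa hob h3 hb1 hsmall
      have ha3 : ¬ 3 ∣ a := fun h => h3 (h.mul_right b)
      have hb3 : ¬ 3 ∣ b := fun h => h3 (h.mul_left a)
      have hnat : 32 * a + 81 ≤ 17 * (a * b) := by
        obtain ⟨i, rfl⟩ := hoa
        obtain ⟨j, rfl⟩ := hob
        rcases Nat.eq_zero_or_pos i with rfl | hi
        · have := hsmall rfl
          omega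
        · have hi2 : 2 ≤ i := by omega
          have : 2 ≤ j := by omega
          nlinarith
      have : (32 : ℝ) * a + 81 ≤ 17 * (a * b) := by exact_mod_cast hnat
      linarith
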